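/- For $\lambda\in(0,\tfrac12)$ and $x\in\mathbb{R}$ put $$\varphi_\lambda(x)=\int_0^{\infty} y^{-2\lambda}\exp\Big\{-\frac{(y-x)^2}{2}\Big\}\,dy .$$ For every $\lambda\in(0,\tfrac12)$ there are a unique $x_1^\lambda<0$ with $\varphi_\lambda''(x_1^\lambda)=0$ and a unique $z^\lambda>0$ with $\varphi_\lambda''(z^\lambda)+\varphi_\lambda''(-z^\lambda)=0$; put $\sigma_\lambda=-x_1^\lambda/z^\lambda$. Let $\sigma\in(0,1)$. Then there is a unique $\lambda_\sigma\in(0,\tfrac12)$ (the critical exponent) with $\sigma_{\lambda_\sigma}=\sigma$, and it satisfies $$\lambda_\sigma>\frac{\sigma^2}{2}.$$ -/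

import Mathlib

open MeasureTheory

namespace GHeat

/-- `φ_λ(x) = ∫_0^∞ y^{-2λ} exp(-(y - x)^2 / 2) dy`. -/
noncomputable def phi (lam x : ℝ) : ℝ :=
  ∫ y in Set.Ioi (0 : ℝ), y ^ (-2 * lam) * Real.exp (-(y - x) ^ 2 / 2)

/-- The second derivative `φ_λ''(x)` of `φ_λ` with respect to `x`. -/
noncomputable def phiDD (lam x : ℝ) : ℝ :=
  deriv (deriv (phi lam)) x

/-- `x` is a negative zero of `φ_λ''`. -/
def IsX1 (lam x : ℝ) : Prop :=
  x < 0 ∧ phiDD lam x = 0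

/-- `z` is a positive zero of `x ↦ φ_λ''(x) + φ_λ''(-x)`. -/
def IsZ (lam z : ℝ) : Prop :=
  0 < z ∧ phiDD lam z + phiDD lam (-z) = 0

/-- `x_1^λ`, the negative zero of `φ_λ''`. -/
noncomputable def x1 (lam : ℝ) : ℝ :=
  Classical.epsilon (IsX1 lam)

/-- `z^λ`, the positive number with `φ_λ''(z^λ) + φ_λ''(-z^λ) = 0`. -/
noncomputable def zCrit (lam : ℝ) : ℝ :=
  Classical.epsilon (IsZ lam)

/-- `σ_λ = - x_1^λ / z^λ`. -/
noncomputable def sigmaCrit (lam : ℝ) : ℝ :=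
  -(x1 lam / zCrit lam)

/-- `λ` lies in `(0, 1/2)` and satisfies `σ_λ = σ`. -/
def IsCritical (sigma lam : ℝ) : Prop :=
  lam ∈ Set.Ioo (0 : ℝ) (1 / 2) ∧ sigmaCrit lam = sigma

/-- The critical exponent `λ_σ`: the number in `(0, 1/2)` with `σ_{λ_σ} = σ`. -/
noncomputable def lambdaCrit (sigma : ℝ) : ℝ :=
  Classical.epsilon (IsCritical sigma)

end GHeat

/-! Integration by parts gives φ'' = -2λφ - xφ', hence (e^{x²/2}φ'')' = -(1+2λ)e^{x²/2}φ'. Since φ'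
> 0 for x ≤ 0, the zero x₁ is unique, and φ'' > 0 wherever x < 0 and x² ≥ 2λ, so x₁² < 2λ
(`x1_sq_lt`). The same device on the even part gives uniqueness of z, and a first integral gives z >
1 (`one_lt_zCrit`). Together σ_λ² < 2λ, which is the claimed bound. For λ_σ itself: x₁ and z both
strictly decrease in λ (`strictAntiOn_x1` by a single sign change, `strictAntiOn_zCrit` by Sturm
comparison), so σ_λ strictly increases. It is continuous, lies below σ at λ = σ²/2 by the bound, and
exceeds σ near λ = 1/2. -/

namespace GHeat

open Set Filter Topology

/-! ### Gaussian moments -/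

/-- The Gaussian moment `∫_0^∞ y^s exp(-(y - x)^2 / 2) dy`. -/
noncomputable def gaussMoment (s x : ℝ) : ℝ :=
  ∫ y in Ioi (0 : ℝ), y ^ s * Real.exp (-(y - x) ^ 2 / 2)

lemma integrableOn_rpow_mul_gauss_bound {s : ℝ} (hs : -1 < s) (c : ℝ) :
    IntegrableOn (fun y : ℝ => y ^ s * Real.exp (c - y ^ 2 / 4)) (Ioi 0) := by
  have h := (integrableOn_rpow_mul_exp_neg_mul_sq (b := 1 / 4) (by norm_num) hs).mul_const
    (Real.exp c)
  refine h.congr (ae_of_all _ fun y => ?_)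
  simp only
  rw [mul_assoc, ← Real.exp_add]
  congr 2
  ring

lemma measurable_rpow_mul_gauss (s x : ℝ) :
    Measurable fun y : ℝ => y ^ s * Real.exp (-(y - x) ^ 2 / 2) := by
  fun_prop

/-- The gap between the exponents is at least (y - 2x)²/4; the bound is uniform over |x| ≤ c, as
domination requires. -/
lemma exp_gauss_le {x c : ℝ} (y : ℝ) (hx : |x| ≤ c) :
    Real.exp (-(y - x) ^ 2 / 2) ≤ Real.exp (c ^ 2 / 2 - y ^ 2 / 4) := by
  apply Real.exp_le_exp.2
  have : x ^ 2 ≤ c ^ 2 := sq_le_sq' (by linarith [neg_abs_le x]) (by linarith [le_abs_self x])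
  nlinarith [sq_nonneg (y - 2 * x)]

lemma integrableOn_rpow_mul_gauss {s : ℝ} (hs : -1 < s) (x : ℝ) :
    IntegrableOn (fun y : ℝ => y ^ s * Real.exp (-(y - x) ^ 2 / 2)) (Ioi 0) := by
  refine (integrableOn_rpow_mul_gauss_bound hs (|x| ^ 2 / 2)).mono'
    (measurable_rpow_mul_gauss s x).aestronglyMeasurable ?_
  filter_upwards [ae_restrict_mem measurableSet_Ioi] with y hy
  have hy0 := Real.rpow_nonneg (le_of_lt (mem_Ioi.1 hy)) s
  rw [Real.norm_of_nonneg (by positivity)]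
  exact mul_le_mul_of_nonneg_left (exp_gauss_le y le_rfl) hy0

lemma gaussMoment_pos {s : ℝ} (hs : -1 < s) (x : ℝ) : 0 < gaussMoment s x := by
  have hpos : ∀ y ∈ Ioi (0 : ℝ), 0 < y ^ s * Real.exp (-(y - x) ^ 2 / 2) := fun y hy =>
    mul_pos (Real.rpow_pos_of_pos hy s) (Real.exp_pos _)
  rw [gaussMoment, setIntegral_pos_iff_support_of_nonneg_ae
    ((ae_restrict_mem measurableSet_Ioi).mono fun y hy => (hpos y hy).le)
    (integrableOn_rpow_mul_gauss hs x)]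
  rw [inter_eq_self_of_subset_right (show Ioi (0 : ℝ) ⊆ Function.support _ from
    fun y hy => Function.mem_support.2 (hpos y hy).ne')]
  simp

lemma hasDerivAt_gaussMoment {s : ℝ} (hs : -1 < s) (x : ℝ) :
    HasDerivAt (gaussMoment s) (gaussMoment (s + 1) x - x * gaussMoment s x) x := by
  have hs1 : -1 < s + 1 := by linarith
  have key := (hasDerivAt_integral_of_dominated_loc_of_deriv_le
    (μ := volume.restrict (Ioi (0 : ℝ))) (x₀ := x) (s := Metric.ball x 1)
    (F := fun x y => y ^ s * Real.exp (-(y - x) ^ 2 / 2))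
    (F' := fun x y => y ^ (s + 1) * Real.exp (-(y - x) ^ 2 / 2)
      - x * (y ^ s * Real.exp (-(y - x) ^ 2 / 2)))
    (bound := fun y => y ^ (s + 1) * Real.exp ((|x| + 1) ^ 2 / 2 - y ^ 2 / 4)
      + (|x| + 1) * (y ^ s * Real.exp ((|x| + 1) ^ 2 / 2 - y ^ 2 / 4)))
    (Metric.ball_mem_nhds x one_pos)
    (Eventually.of_forall fun x => (measurable_rpow_mul_gauss s x).aestronglyMeasurable)
    (integrableOn_rpow_mul_gauss hs x)
    ((measurable_rpow_mul_gauss (s + 1) x).sub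
      ((measurable_rpow_mul_gauss s x).const_mul x)).aestronglyMeasurable
    ?_ ((integrableOn_rpow_mul_gauss_bound hs1 _).add
      ((integrableOn_rpow_mul_gauss_bound hs _).const_mul _)) ?_).2
  · rw [integral_sub (integrableOn_rpow_mul_gauss hs1 x)
      ((integrableOn_rpow_mul_gauss hs x).const_mul x), integral_const_mul] at key
    exact key
  · filter_upwards [ae_restrict_mem measurableSet_Ioi] with y hy u hu
    have hy0 : (0 : ℝ) < y := hy
    have hu' : |u| ≤ |x| + 1 := by
      rw [Metric.mem_ball, Real.dist_eq] at hu
      have := abs_sub_abs_le_abs_sub u x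
      linarith
    have hE := exp_gauss_le y hu'
    have h1 := Real.rpow_nonneg hy0.le s
    have h2 := Real.rpow_nonneg hy0.le (s + 1)
    refine (norm_sub_le _ _).trans (add_le_add ?_ ?_)
    · rw [Real.norm_of_nonneg (by positivity)]
      exact mul_le_mul_of_nonneg_left hE h2
    · rw [norm_mul, Real.norm_eq_abs u, Real.norm_of_nonneg (by positivity)]
      exact mul_le_mul hu' (mul_le_mul_of_nonneg_left hE h1) (by positivity) (by positivity)
  · filter_upwards [ae_restrict_mem measurableSet_Ioi] with y hy u _
    have hy0 : (0 : ℝ) < y := hy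
    have h : HasDerivAt (fun u : ℝ => -(y - u) ^ 2 / 2) (y - u) u := by
      refine (((((hasDerivAt_id u).const_sub y).pow 2).neg).div_const 2).congr_deriv ?_
      simp
    refine ((h.exp).const_mul (y ^ s)).congr_deriv ?_
    rw [Real.rpow_add_one hy0.ne']
    ring

lemma hasDerivAt_gauss (x y : ℝ) :
    HasDerivAt (fun y : ℝ => Real.exp (-(y - x) ^ 2 / 2))
      (Real.exp (-(y - x) ^ 2 / 2) * (x - y)) y := by
  refine (((((hasDerivAt_id y).sub_const x).pow 2).neg).div_const 2).exp.congr_deriv ?_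
  simp only [Pi.neg_apply, Pi.pow_apply, id_eq]
  ring

/-- Integrate the derivative of y^{s+1}e^{-(y-x)²/2}; both boundary terms vanish because s + 1 > 0.
-/
lemma gaussMoment_add_two {s : ℝ} (hs : -1 < s) (x : ℝ) :
    (s + 1) * gaussMoment s x = gaussMoment (s + 2) x - x * gaussMoment (s + 1) x := by
  have hs1 : -1 < s + 1 := by linarith
  have hs2 : -1 < s + 2 := by linarith
  set f' : ℝ → ℝ := fun y => (s + 1) * (y ^ s * Real.exp (-(y - x) ^ 2 / 2))
    - (y ^ (s + 2) * Real.exp (-(y - x) ^ 2 / 2)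
      - x * (y ^ (s + 1) * Real.exp (-(y - x) ^ 2 / 2))) with hf'
  have i0 := (integrableOn_rpow_mul_gauss hs x).const_mul (s + 1)
  have i1 := (integrableOn_rpow_mul_gauss hs1 x).const_mul x
  have i2 := integrableOn_rpow_mul_gauss hs2 x
  have hint : IntegrableOn f' (Ioi 0) := i0.sub (i2.sub i1)
  have hd : ∀ y ∈ Ioi (0 : ℝ),
      HasDerivAt (fun y => y ^ (s + 1) * Real.exp (-(y - x) ^ 2 / 2)) (f' y) y := by
    intro y hy
    have hy0 : (0 : ℝ) < y := hy
    refine ((Real.hasDerivAt_rpow_const (p := s + 1) (Or.inl hy0.ne')).mul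
      (hasDerivAt_gauss x y)).congr_deriv ?_
    simp only [hf']
    rw [show s + 2 = s + 1 + 1 by ring, Real.rpow_add_one hy0.ne' (s + 1)]
    simp only [add_sub_cancel_right]
    ring
  have hlim := tendsto_zero_of_hasDerivAt_of_integrableOn_Ioi hd hint
    (integrableOn_rpow_mul_gauss hs1 x)
  have hcont : ContinuousWithinAt (fun y : ℝ => y ^ (s + 1) * Real.exp (-(y - x) ^ 2 / 2))
      (Ici 0) 0 := by
    apply ContinuousAt.continuousWithinAt
    exact (Real.continuousAt_rpow_const _ _ (Or.inr (by linarith))).mul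
      (hasDerivAt_gauss x 0).continuousAt
  have h := integral_Ioi_of_hasDerivAt_of_tendsto hcont hd hint hlim
  have e : ∫ y in Ioi 0, f' y = (s + 1) * gaussMoment s x
      - (gaussMoment (s + 2) x - x * gaussMoment (s + 1) x) := by
    refine (integral_sub i0 (i2.sub i1)).trans (congrArg₂ _ (integral_const_mul _ _) ?_)
    exact (integral_sub i2 i1).trans (congrArg₂ _ rfl (integral_const_mul _ _))
  rw [e, Real.zero_rpow (by linarith)] at h
  linarith

/-- The borderline s = -1 of the recurrence, where the boundary term at 0 survives. -/
lemma gaussMoment_one (x : ℝ) :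
    gaussMoment 1 x - x * gaussMoment 0 x = Real.exp (-x ^ 2 / 2) := by
  have i0 := (integrableOn_rpow_mul_gauss (s := 0) (by norm_num) x)
  have i1 := (integrableOn_rpow_mul_gauss (s := 1) (by norm_num) x)
  have hd : ∀ y ∈ Ici (0 : ℝ), HasDerivAt (fun y => Real.exp (-(y - x) ^ 2 / 2))
      (x * (y ^ (0 : ℝ) * Real.exp (-(y - x) ^ 2 / 2))
        - y ^ (1 : ℝ) * Real.exp (-(y - x) ^ 2 / 2)) y := by
    intro y _
    refine (hasDerivAt_gauss x y).congr_deriv ?_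
    rw [Real.rpow_zero, Real.rpow_one]
    ring
  have hint := (i0.const_mul x).sub i1
  have hlim := tendsto_zero_of_hasDerivAt_of_integrableOn_Ioi
    (fun y hy => hd y (le_of_lt (mem_Ioi.1 hy))) hint (by simpa using i0)
  have h := integral_Ioi_of_hasDerivAt_of_tendsto' hd hint hlim
  rw [integral_sub (i0.const_mul x) i1, integral_const_mul] at h
  simp only [gaussMoment]
  simp only [zero_sub, neg_sq] at h
  linarith

lemma continuousAt_gaussMoment {s : ℝ} (hs : -1 < s) (x : ℝ) :
    ContinuousAt (fun t => gaussMoment t x) s := by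
  obtain ⟨a, ha, has⟩ := exists_between hs
  have hb : -1 < s + 1 := by linarith
  -- For a < t < s + 1, y^t is dominated by y^a when y ≤ 1 and by y^{s+1} when y ≥ 1.
  refine continuousAt_of_dominated (bound := fun y =>
    y ^ a * Real.exp (-(y - x) ^ 2 / 2) + y ^ (s + 1) * Real.exp (-(y - x) ^ 2 / 2))
    (Eventually.of_forall fun t => (measurable_rpow_mul_gauss t x).aestronglyMeasurable) ?_
    ((integrableOn_rpow_mul_gauss ha x).add (integrableOn_rpow_mul_gauss hb x)) ?_
  · filter_upwards [Ioo_mem_nhds has (lt_add_one s)] with t ht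
    filter_upwards [ae_restrict_mem measurableSet_Ioi] with y hy
    have hy0 : (0 : ℝ) < y := hy
    rw [Real.norm_of_nonneg (by positivity), ← add_mul]
    refine mul_le_mul_of_nonneg_right ?_ (Real.exp_pos _).le
    rcases le_total y 1 with h | h
    · have := Real.rpow_le_rpow_of_exponent_ge hy0 h ht.1.le
      have := Real.rpow_nonneg hy0.le (s + 1)
      linarith
    · have := Real.rpow_le_rpow_of_exponent_le h ht.2.le
      have := Real.rpow_nonneg hy0.le a
      linarith
  · filter_upwards [ae_restrict_mem measurableSet_Ioi] with y hy
    exact (Real.continuousAt_const_rpow (ne_of_gt (mem_Ioi.1 hy))).mul continuousAt_const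

/-! ### Differential equation for φ -/

/-- The first derivative of `phi lam`. -/
noncomputable def phiD (lam x : ℝ) : ℝ :=
  gaussMoment (-2 * lam + 1) x - x * phi lam x

lemma phi_pos {lam : ℝ} (h : lam < 1 / 2) (x : ℝ) : 0 < phi lam x :=
  gaussMoment_pos (by linarith) x

lemma hasDerivAt_phi {lam : ℝ} (h : lam < 1 / 2) (x : ℝ) :
    HasDerivAt (phi lam) (phiD lam x) x :=
  hasDerivAt_gaussMoment (s := -2 * lam) (by linarith) x

lemma phi_recurrence {lam : ℝ} (h : lam < 1 / 2) (x : ℝ) :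
    (1 - 2 * lam) * phi lam x
      = gaussMoment (-2 * lam + 2) x - x * gaussMoment (-2 * lam + 1) x := by
  have := gaussMoment_add_two (s := -2 * lam) (by linarith) x
  change (-2 * lam + 1) * phi lam x = _ at this
  linarith

lemma hasDerivAt_phiD_aux {lam : ℝ} (h : lam < 1 / 2) (x : ℝ) :
    HasDerivAt (phiD lam) (-2 * lam * phi lam x - x * phiD lam x) x := by
  refine ((hasDerivAt_gaussMoment (s := -2 * lam + 1) (by linarith) x).sub
    ((hasDerivAt_id x).mul (hasDerivAt_phi h x))).congr_deriv ?_
  have := phi_recurrence h x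
  rw [show -2 * lam + 1 + 1 = -2 * lam + 2 by ring]
  simp only [id_eq]
  linarith

lemma phiDD_eq {lam : ℝ} (h : lam < 1 / 2) (x : ℝ) :
    phiDD lam x = -2 * lam * phi lam x - x * phiD lam x := by
  have : deriv (phi lam) = phiD lam := funext fun x => (hasDerivAt_phi h x).deriv
  rw [phiDD, this, (hasDerivAt_phiD_aux h x).deriv]

lemma hasDerivAt_phiD {lam : ℝ} (h : lam < 1 / 2) (x : ℝ) :
    HasDerivAt (phiD lam) (phiDD lam x) x := by
  rw [phiDD_eq h]
  exact hasDerivAt_phiD_aux h x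

lemma hasDerivAt_phiDD {lam : ℝ} (h : lam < 1 / 2) (x : ℝ) :
    HasDerivAt (phiDD lam) (-(1 + 2 * lam) * phiD lam x - x * phiDD lam x) x := by
  rw [show phiDD lam = fun x => -2 * lam * phi lam x - x * phiD lam x from
    funext (phiDD_eq h)]
  refine (((hasDerivAt_phi h x).const_mul (-2 * lam)).sub
    ((hasDerivAt_id x).mul (hasDerivAt_phiD h x))).congr_deriv ?_
  rw [phiDD_eq h]
  simp only [id_eq]
  ring

lemma phiDD_eq_gaussMoment {lam : ℝ} (h : lam < 1 / 2) (x : ℝ) :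
    phiDD lam x = (x ^ 2 - 2 * lam) * gaussMoment (-2 * lam) x
      - x * gaussMoment (-2 * lam + 1) x := by
  rw [phiDD_eq h, phiD]
  change -2 * lam * gaussMoment (-2 * lam) x
    - x * (gaussMoment (-2 * lam + 1) x - x * gaussMoment (-2 * lam) x) = _
  ring

/-- Eliminates the moment of order -2λ, the only one that diverges as λ → 1/2. -/
lemma one_sub_mul_phiDD {lam : ℝ} (h : lam < 1 / 2) (x : ℝ) :
    (1 - 2 * lam) * phiDD lam x = (x ^ 2 - 2 * lam) * gaussMoment (-2 * lam + 2) x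
      - x * (x ^ 2 + 1 - 4 * lam) * gaussMoment (-2 * lam + 1) x := by
  have := phi_recurrence h x
  rw [phiDD_eq h, phiD]
  linear_combination (x ^ 2 - 2 * lam) * this

lemma phiDD_eq_integral {lam : ℝ} (h : lam < 1 / 2) (x : ℝ) :
    IntegrableOn (fun y : ℝ => ((y - x) ^ 2 - 1)
        * (y ^ (-2 * lam) * Real.exp (-(y - x) ^ 2 / 2))) (Ioi 0) ∧
      phiDD lam x = ∫ y in Ioi (0 : ℝ), ((y - x) ^ 2 - 1)
        * (y ^ (-2 * lam) * Real.exp (-(y - x) ^ 2 / 2)) := by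
  have i0 := (integrableOn_rpow_mul_gauss (s := -2 * lam) (by linarith) x).const_mul (x ^ 2 - 1)
  have i1 := (integrableOn_rpow_mul_gauss (s := -2 * lam + 1) (by linarith) x).const_mul (2 * x)
  have i2 := integrableOn_rpow_mul_gauss (s := -2 * lam + 2) (by linarith) x
  have e : EqOn (fun y : ℝ => y ^ (-2 * lam + 2) * Real.exp (-(y - x) ^ 2 / 2)
      - 2 * x * (y ^ (-2 * lam + 1) * Real.exp (-(y - x) ^ 2 / 2))
      + (x ^ 2 - 1) * (y ^ (-2 * lam) * Real.exp (-(y - x) ^ 2 / 2)))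
      (fun y : ℝ => ((y - x) ^ 2 - 1)
        * (y ^ (-2 * lam) * Real.exp (-(y - x) ^ 2 / 2))) (Ioi 0) := by
    intro y hy
    have hy0 : (0 : ℝ) < y := hy
    simp only
    rw [show -2 * lam + 2 = -2 * lam + 1 + 1 by ring, Real.rpow_add_one hy0.ne',
      Real.rpow_add_one hy0.ne']
    ring
  refine ⟨((i2.sub i1).add i0).congr_fun e measurableSet_Ioi, ?_⟩
  rw [← setIntegral_congr_fun measurableSet_Ioi e]
  refine Eq.symm ((integral_add (i2.sub i1) i0).trans ((congrArg₂ _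
    ((integral_sub i2 i1).trans (congrArg₂ _ rfl (integral_const_mul _ _)))
    (integral_const_mul _ _)).trans ?_))
  change gaussMoment (-2 * lam + 2) x - 2 * x * gaussMoment (-2 * lam + 1) x
    + (x ^ 2 - 1) * phi lam x = _
  rw [phiDD_eq h, phiD]
  linarith [phi_recurrence h x]

/-! ### The negative zero x₁ -/

lemma phiD_pos {lam : ℝ} (h : lam < 1 / 2) {x : ℝ} (hx : x ≤ 0) : 0 < phiD lam x := by
  have h1 := gaussMoment_pos (s := -2 * lam + 1) (by linarith) x
  have h2 := phi_pos h x
  unfold phiD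
  nlinarith

lemma hasDerivAt_exp_sq (x : ℝ) :
    HasDerivAt (fun x : ℝ => Real.exp (x ^ 2 / 2)) (x * Real.exp (x ^ 2 / 2)) x := by
  refine ((((hasDerivAt_id x).pow 2).div_const 2).exp).congr_deriv ?_
  simp only [Pi.pow_apply, id_eq]
  ring

/-- A function whose derivative is positive on the open half-line is strictly increasing on the
closed half-line. -/
lemma strictMonoOn_Ici_of_hasDerivAt {f f' : ℝ → ℝ} {a : ℝ} (hf : ∀ x, HasDerivAt f (f' x) x)
    (hf' : ∀ x, a < x → 0 < f' x) : StrictMonoOn f (Ici a) := by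
  refine strictMonoOn_of_deriv_pos (convex_Ici a)
    (fun x _ => (hf x).continuousAt.continuousWithinAt) fun x hx => ?_
  rw [interior_Ici] at hx
  rw [(hf x).deriv]
  exact hf' x hx

lemma strictAntiOn_exp_mul_phiDD {lam : ℝ} (h : lam ∈ Ioo (0 : ℝ) (1 / 2)) :
    StrictAntiOn (fun x => Real.exp (x ^ 2 / 2) * phiDD lam x) (Iic 0) := by
  have hd : ∀ x, HasDerivAt (fun x => Real.exp (x ^ 2 / 2) * phiDD lam x)
      (-((1 + 2 * lam) * Real.exp (x ^ 2 / 2) * phiD lam x)) x := fun x => by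
    refine ((hasDerivAt_exp_sq x).mul (hasDerivAt_phiDD h.2 x)).congr_deriv ?_
    ring
  refine strictAntiOn_of_deriv_neg (convex_Iic 0)
    (fun x _ => (hd x).continuousAt.continuousWithinAt) fun x hx => ?_
  rw [interior_Iic] at hx
  rw [(hd x).deriv]
  have h1 := phiD_pos h.2 (le_of_lt (mem_Iio.1 hx))
  have h2 := h.1
  have : 0 < (1 + 2 * lam) * Real.exp (x ^ 2 / 2) * phiD lam x := by positivity
  linarith

lemma phiDD_zero_neg {lam : ℝ} (h : lam ∈ Ioo (0 : ℝ) (1 / 2)) : phiDD lam 0 < 0 := by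
  have := mul_pos h.1 (phi_pos h.2 0)
  rw [phiDD_eq h.2]
  linarith

lemma phiDD_pos_of_two_mul_le_sq {lam : ℝ} (h : lam ∈ Ioo (0 : ℝ) (1 / 2)) {x : ℝ} (hx : x < 0)
    (hx2 : 2 * lam ≤ x ^ 2) : 0 < phiDD lam x := by
  rw [phiDD_eq_gaussMoment h.2]
  have h0 := gaussMoment_pos (s := -2 * lam) (by linarith [h.2]) x
  have h1 := gaussMoment_pos (s := -2 * lam + 1) (by linarith [h.2]) x
  nlinarith

lemma continuous_phiDD {lam : ℝ} (h : lam < 1 / 2) : Continuous (phiDD lam) :=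
  continuous_iff_continuousAt.2 fun x => (hasDerivAt_phiDD h x).continuousAt

theorem existsUnique_isX1 {lam : ℝ} (h : lam ∈ Ioo (0 : ℝ) (1 / 2)) :
    ∃! x, IsX1 lam x := by
  have hm := phiDD_pos_of_two_mul_le_sq h (x := -1) (by norm_num) (by linarith [h.2])
  obtain ⟨x, hx, hx0⟩ := intermediate_value_Ioo' (by norm_num : (-1 : ℝ) ≤ 0)
    (continuous_phiDD h.2).continuousOn ⟨phiDD_zero_neg h, hm⟩
  refine ⟨x, ⟨hx.2, hx0⟩, fun y hy => ?_⟩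
  exact (strictAntiOn_exp_mul_phiDD h).injOn (le_of_lt hy.1) hx.2.le (by simp [hy.2, hx0])

lemma isX1_x1 {lam : ℝ} (h : lam ∈ Ioo (0 : ℝ) (1 / 2)) : IsX1 lam (x1 lam) :=
  Classical.epsilon_spec (existsUnique_isX1 h).exists

lemma x1_sq_lt {lam : ℝ} (h : lam ∈ Ioo (0 : ℝ) (1 / 2)) : x1 lam ^ 2 < 2 * lam := by
  by_contra! hc
  exact (phiDD_pos_of_two_mul_le_sq h (isX1_x1 h).1 hc).ne' (isX1_x1 h).2

/-- Locating x₁ reduces to a sign of φ'' at a fixed point, where dependence on λ is easy to control.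
-/
lemma lt_x1_iff {lam x : ℝ} (h : lam ∈ Ioo (0 : ℝ) (1 / 2)) (hx : x < 0) :
    x < x1 lam ↔ 0 < phiDD lam x := by
  rw [← (strictAntiOn_exp_mul_phiDD h).lt_iff_gt (isX1_x1 h).1.le hx.le]
  simp [(isX1_x1 h).2, Real.exp_pos]

lemma x1_lt_iff {lam x : ℝ} (h : lam ∈ Ioo (0 : ℝ) (1 / 2)) (hx : x < 0) :
    x1 lam < x ↔ phiDD lam x < 0 := by
  rw [← (strictAntiOn_exp_mul_phiDD h).lt_iff_gt hx.le (isX1_x1 h).1.le]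
  simp [(isX1_x1 h).2, mul_neg_iff, Real.exp_pos, (Real.exp_pos _).not_gt]

theorem strictAntiOn_x1 : StrictAntiOn x1 (Ioo (0 : ℝ) (1 / 2)) := by
  intro lam hl mu hm hlm
  have hx := isX1_x1 hl
  set x := x1 lam
  have hx1 : -1 < x := by nlinarith [x1_sq_lt hl, hl.2]
  have hc : 0 < 1 + x := by linarith
  rw [x1_lt_iff hm hx.1]
  obtain ⟨il, el⟩ := phiDD_eq_integral hl.2 x
  obtain ⟨im, em⟩ := phiDD_eq_integral hm.2 x
  rw [hx.2] at el
  -- As -1 < x < 0, the factor (y-x)² - 1 changes sign on y > 0 only at y = 1 + x. The decreasing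
  -- weight y^{-2(μ-λ)}, compared with its value there, lowers the integral on both sides.
  have hneg : ∀ y ∈ Ioi (0 : ℝ), y ≠ 1 + x →
      0 < (1 + x) ^ (-2 * (mu - lam)) * (((y - x) ^ 2 - 1)
        * (y ^ (-2 * lam) * Real.exp (-(y - x) ^ 2 / 2)))
      - ((y - x) ^ 2 - 1) * (y ^ (-2 * mu) * Real.exp (-(y - x) ^ 2 / 2)) := by
    intro y hy hne
    have hy0 : (0 : ℝ) < y := hy
    have e1 : y ^ (-2 * mu) = y ^ (-2 * (mu - lam)) * y ^ (-2 * lam) := by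
      rw [← Real.rpow_add hy0]
      ring_nf
    have e2 : (1 + x) ^ (-2 * (mu - lam)) * (((y - x) ^ 2 - 1)
        * (y ^ (-2 * lam) * Real.exp (-(y - x) ^ 2 / 2)))
      - ((y - x) ^ 2 - 1) * (y ^ (-2 * mu) * Real.exp (-(y - x) ^ 2 / 2))
      = ((y - x) ^ 2 - 1) * ((1 + x) ^ (-2 * (mu - lam)) - y ^ (-2 * (mu - lam)))
        * (y ^ (-2 * lam) * Real.exp (-(y - x) ^ 2 / 2)) := by
      rw [e1]
      ring
    rw [e2]
    refine mul_pos ?_ (mul_pos (Real.rpow_pos_of_pos hy0 _) (Real.exp_pos _))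
    rcases lt_or_gt_of_ne hne with hlt | hgt
    · have := Real.rpow_lt_rpow_of_neg hy0 hlt (by linarith : -2 * (mu - lam) < 0)
      exact mul_pos_of_neg_of_neg (by nlinarith [hx.1]) (by linarith)
    · have := Real.rpow_lt_rpow_of_neg hc hgt (by linarith : -2 * (mu - lam) < 0)
      exact mul_pos (by nlinarith [hx.1]) (by linarith)
  have hpos : 0 < ∫ y in Ioi (0 : ℝ), ((1 + x) ^ (-2 * (mu - lam)) * (((y - x) ^ 2 - 1)
        * (y ^ (-2 * lam) * Real.exp (-(y - x) ^ 2 / 2)))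
      - ((y - x) ^ 2 - 1) * (y ^ (-2 * mu) * Real.exp (-(y - x) ^ 2 / 2))) := by
    refine (setIntegral_pos_iff_support_of_nonneg_ae ?_ ((il.const_mul _).sub im)).2 ?_
    rotate_left
    · refine lt_of_lt_of_le ?_ (measure_mono (show Ioi (1 + x) ⊆ _ from fun y hy => ?_))
      · simp
      · have hy' : 1 + x < y := hy
        exact ⟨(hneg y (hc.trans hy') hy'.ne').ne', hc.trans hy'⟩
    · have hae : ∀ᵐ y ∂(volume.restrict (Ioi (0 : ℝ))), y ≠ 1 + x :=
        ae_restrict_of_ae (Measure.ae_ne volume (1 + x))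
      filter_upwards [ae_restrict_mem measurableSet_Ioi, hae] with y hy hne
      exact (hneg y hy hne).le
  rw [integral_sub (il.const_mul _) im, integral_const_mul, ← el, ← em] at hpos
  linarith

/-! ### The even part and its inflection point z -/

/-- Minus the derivative of `x ↦ phi lam x + phi lam (-x)`. -/
noncomputable def evenSlope (lam x : ℝ) : ℝ :=
  phiD lam (-x) - phiD lam x

/-- The second derivative of `x ↦ phi lam x + phi lam (-x)`. -/
noncomputable def evenDD (lam x : ℝ) : ℝ :=
  phiDD lam x + phiDD lam (-x)

lemma hasDerivAt_even {lam : ℝ} (h : lam < 1 / 2) (x : ℝ) :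
    HasDerivAt (fun x => phi lam x + phi lam (-x)) (-evenSlope lam x) x := by
  refine ((hasDerivAt_phi h x).add
    ((hasDerivAt_phi h (-x)).comp x (hasDerivAt_neg x))).congr_deriv ?_
  simp only [evenSlope]
  ring

lemma hasDerivAt_evenSlope {lam : ℝ} (h : lam < 1 / 2) (x : ℝ) :
    HasDerivAt (evenSlope lam) (-evenDD lam x) x := by
  refine (((hasDerivAt_phiD h (-x)).comp x (hasDerivAt_neg x)).sub
    (hasDerivAt_phiD h x)).congr_deriv ?_
  simp only [evenDD]
  ring

lemma hasDerivAt_evenDD {lam : ℝ} (h : lam < 1 / 2) (x : ℝ) :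
    HasDerivAt (evenDD lam) ((1 + 2 * lam) * evenSlope lam x - x * evenDD lam x) x := by
  refine ((hasDerivAt_phiDD h x).add
    ((hasDerivAt_phiDD h (-x)).comp x (hasDerivAt_neg x))).congr_deriv ?_
  simp only [evenDD, evenSlope]
  ring

lemma evenDD_eq {lam : ℝ} (h : lam < 1 / 2) (x : ℝ) :
    evenDD lam x = x * evenSlope lam x - 2 * lam * (phi lam x + phi lam (-x)) := by
  simp only [evenDD, evenSlope, phiDD_eq h]
  ring

lemma evenSlope_zero (lam : ℝ) : evenSlope lam 0 = 0 := by
  simp [evenSlope]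

lemma evenSlope_pos {lam : ℝ} (h : lam ∈ Ioo (0 : ℝ) (1 / 2)) {x : ℝ} (hx : 0 < x) :
    0 < evenSlope lam x := by
  have hd : ∀ x, HasDerivAt (fun x => Real.exp (x ^ 2 / 2) * evenSlope lam x)
      (Real.exp (x ^ 2 / 2) * (2 * lam * (phi lam x + phi lam (-x)))) x := fun x => by
    refine ((hasDerivAt_exp_sq x).mul (hasDerivAt_evenSlope h.2 x)).congr_deriv ?_
    rw [evenDD_eq h.2]
    ring
  have := strictMonoOn_Ici_of_hasDerivAt (a := 0) hd (fun x _ => by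
    have := phi_pos h.2 x
    have := phi_pos h.2 (-x)
    have := h.1
    positivity) self_mem_Ici hx.le hx
  simp only [evenSlope_zero, mul_zero] at this
  exact pos_of_mul_pos_right this (Real.exp_pos _).le

lemma strictMonoOn_exp_mul_evenDD {lam : ℝ} (h : lam ∈ Ioo (0 : ℝ) (1 / 2)) :
    StrictMonoOn (fun x => Real.exp (x ^ 2 / 2) * evenDD lam x) (Ici 0) := by
  have hd : ∀ x, HasDerivAt (fun x => Real.exp (x ^ 2 / 2) * evenDD lam x)
      (Real.exp (x ^ 2 / 2) * ((1 + 2 * lam) * evenSlope lam x)) x := fun x => by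
    refine ((hasDerivAt_exp_sq x).mul (hasDerivAt_evenDD h.2 x)).congr_deriv ?_
    ring
  refine strictMonoOn_Ici_of_hasDerivAt hd fun x hx => ?_
  have := evenSlope_pos h hx
  have := h.1
  positivity

lemma evenDD_zero_neg {lam : ℝ} (h : lam ∈ Ioo (0 : ℝ) (1 / 2)) : evenDD lam 0 < 0 := by
  have := phiDD_zero_neg h
  simp only [evenDD, neg_zero]
  linarith

/-- Otherwise the even part would be concave on x > 0 with slope at most -r < 0 beyond 1, and would
fail to be positive at 1 + A/r. -/
lemma exists_evenDD_pos {lam : ℝ} (h : lam ∈ Ioo (0 : ℝ) (1 / 2)) :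
    ∃ x, 0 < x ∧ 0 < evenDD lam x := by
  by_contra! hc
  have hmono : MonotoneOn (evenSlope lam) (Ici 1) := by
    refine monotoneOn_of_deriv_nonneg (convex_Ici 1)
      (fun x _ => (hasDerivAt_evenSlope h.2 x).continuousAt.continuousWithinAt)
      (fun x _ => (hasDerivAt_evenSlope h.2 x).differentiableAt.differentiableWithinAt)
      fun x hx => ?_
    rw [interior_Ici] at hx
    rw [(hasDerivAt_evenSlope h.2 x).deriv]
    linarith [hc x (one_pos.trans hx)]
  have hr := evenSlope_pos h one_pos
  set r := evenSlope lam 1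
  have hd : ∀ x, HasDerivAt (fun x => phi lam x + phi lam (-x) + r * x)
      (-evenSlope lam x + r) x := fun x => by
    refine ((hasDerivAt_even h.2 x).add ((hasDerivAt_id x).const_mul r)).congr_deriv ?_
    ring
  have hanti : AntitoneOn (fun x => phi lam x + phi lam (-x) + r * x) (Ici 1) := by
    refine antitoneOn_of_deriv_nonpos (convex_Ici 1)
      (fun x _ => (hd x).continuousAt.continuousWithinAt)
      (fun x _ => (hd x).differentiableAt.differentiableWithinAt) fun x hx => ?_
    rw [interior_Ici] at hx
    rw [(hd x).deriv]
    linarith [hmono self_mem_Ici (le_of_lt (mem_Ioi.1 hx)) (le_of_lt (mem_Ioi.1 hx))]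
  have hA := add_pos (phi_pos h.2 1) (phi_pos h.2 (-1))
  set A := phi lam 1 + phi lam (-1)
  have hb : 1 ≤ 1 + A / r := by
    have : 0 < A / r := by positivity
    linarith
  have := hanti self_mem_Ici hb hb
  have e : r * (1 + A / r) = r * 1 + A := by
    field_simp
  simp only [e] at this
  linarith [phi_pos h.2 (1 + A / r), phi_pos h.2 (-(1 + A / r))]

lemma continuous_evenDD {lam : ℝ} (h : lam < 1 / 2) : Continuous (evenDD lam) :=
  continuous_iff_continuousAt.2 fun x => (hasDerivAt_evenDD h x).continuousAt

theorem existsUnique_isZ {lam : ℝ} (h : lam ∈ Ioo (0 : ℝ) (1 / 2)) :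
    ∃! z, IsZ lam z := by
  obtain ⟨w, hw, hwpos⟩ := exists_evenDD_pos h
  obtain ⟨z, hz, hz0⟩ := intermediate_value_Ioo hw.le
    (continuous_evenDD h.2).continuousOn ⟨evenDD_zero_neg h, hwpos⟩
  refine ⟨z, ⟨hz.1, hz0⟩, fun y hy => ?_⟩
  have hy0 : evenDD lam y = 0 := hy.2
  exact (strictMonoOn_exp_mul_evenDD h).injOn (le_of_lt hy.1) hz.1.le (by simp [hy0, hz0])

lemma isZ_zCrit {lam : ℝ} (h : lam ∈ Ioo (0 : ℝ) (1 / 2)) : IsZ lam (zCrit lam) :=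
  Classical.epsilon_spec (existsUnique_isZ h).exists

lemma evenDD_zCrit {lam : ℝ} (h : lam ∈ Ioo (0 : ℝ) (1 / 2)) : evenDD lam (zCrit lam) = 0 :=
  (isZ_zCrit h).2

lemma lt_zCrit_iff {lam x : ℝ} (h : lam ∈ Ioo (0 : ℝ) (1 / 2)) (hx : 0 < x) :
    x < zCrit lam ↔ evenDD lam x < 0 := by
  rw [← (strictMonoOn_exp_mul_evenDD h).lt_iff_lt hx.le (isZ_zCrit h).1.le]
  simp [evenDD_zCrit h, mul_neg_iff, Real.exp_pos, (Real.exp_pos _).not_gt]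

lemma zCrit_lt_iff {lam x : ℝ} (h : lam ∈ Ioo (0 : ℝ) (1 / 2)) (hx : 0 < x) :
    zCrit lam < x ↔ 0 < evenDD lam x := by
  rw [← (strictMonoOn_exp_mul_evenDD h).lt_iff_lt (isZ_zCrit h).1.le hx.le]
  simp [evenDD_zCrit h, Real.exp_pos]

theorem one_lt_zCrit {lam : ℝ} (h : lam ∈ Ioo (0 : ℝ) (1 / 2)) : 1 < zCrit lam := by
  have hz := isZ_zCrit h
  have hz0 := evenDD_zCrit h
  set z := zCrit lam
  -- This combination vanishes at 0 and increases; at z, where `evenDD` is zero, it equals (z² - 1)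
  -- times the positive slope.
  have hd : ∀ x, HasDerivAt
      (fun x => x ^ 2 * evenSlope lam x - x * evenDD lam x - evenSlope lam x)
      ((1 - 2 * lam) * (x * evenSlope lam x)) x := fun x => by
    refine (((((hasDerivAt_id x).pow 2).mul (hasDerivAt_evenSlope h.2 x)).sub
      ((hasDerivAt_id x).mul (hasDerivAt_evenDD h.2 x))).sub
      (hasDerivAt_evenSlope h.2 x)).congr_deriv ?_
    simp only [Pi.pow_apply, id_eq]
    ring
  have := strictMonoOn_Ici_of_hasDerivAt (a := 0) hd (fun x hx =>
    mul_pos (by linarith [h.2]) (mul_pos hx (evenSlope_pos h hx))) self_mem_Ici hz.1.le hz.1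
  simp only [hz0, evenSlope_zero] at this
  have hR := evenSlope_pos h hz.1
  have : 0 < evenSlope lam z * (z ^ 2 - 1) := by linarith
  nlinarith [pos_of_mul_pos_right this hR.le, hz.1]

/-- Sturm comparison of the odd functions `evenSlope lam` and `evenSlope mu`. -/
theorem strictAntiOn_zCrit : StrictAntiOn zCrit (Ioo (0 : ℝ) (1 / 2)) := by
  intro lam hl mu hm hlm
  have hz := isZ_zCrit hl
  have hz0 := evenDD_zCrit hl
  set z := zCrit lam
  rw [zCrit_lt_iff hm hz.1]
  -- The Wronskian with integrating factor e^{x²/2}: it vanishes at 0, and at z only the term with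
  -- `evenDD mu` remains.
  have hd : ∀ x, HasDerivAt (fun x => Real.exp (x ^ 2 / 2)
        * (evenSlope lam x * evenDD mu x - evenDD lam x * evenSlope mu x))
      (2 * (mu - lam) * (Real.exp (x ^ 2 / 2) * (evenSlope lam x * evenSlope mu x))) x :=
    fun x => by
    refine ((hasDerivAt_exp_sq x).mul
      (((hasDerivAt_evenSlope hl.2 x).mul (hasDerivAt_evenDD hm.2 x)).sub
      ((hasDerivAt_evenDD hl.2 x).mul (hasDerivAt_evenSlope hm.2 x)))).congr_deriv ?_
    simp only [Pi.mul_apply, Pi.sub_apply]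
    ring
  have := strictMonoOn_Ici_of_hasDerivAt (a := 0) hd (fun x hx =>
    mul_pos (by linarith) (mul_pos (Real.exp_pos _)
      (mul_pos (evenSlope_pos hl hx) (evenSlope_pos hm hx)))) self_mem_Ici hz.1.le hz.1
  simp only [hz0, evenSlope_zero, zero_mul, mul_zero, sub_zero] at this
  exact pos_of_mul_pos_right (pos_of_mul_pos_right this (Real.exp_pos _).le)
    (evenSlope_pos hl hz.1).le

/-! ### Continuity in λ and the limit λ → 1/2 -/

lemma continuousAt_phiDD_left {lam : ℝ} (h : lam < 1 / 2) (x : ℝ) :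
    ContinuousAt (fun l => phiDD l x) lam := by
  have c0 : ContinuousAt (fun l : ℝ => gaussMoment (-2 * l) x) lam :=
    (continuousAt_gaussMoment (s := -2 * lam) (by linarith) x).comp
      (f := fun l : ℝ => -2 * l) (by fun_prop)
  have c1 : ContinuousAt (fun l : ℝ => gaussMoment (-2 * l + 1) x) lam :=
    (continuousAt_gaussMoment (s := -2 * lam + 1) (by linarith) x).comp
      (f := fun l : ℝ => -2 * l + 1) (by fun_prop)
  have hc : ContinuousAt (fun l : ℝ => (x ^ 2 - 2 * l) * gaussMoment (-2 * l) x
      - x * gaussMoment (-2 * l + 1) x) lam := by fun_prop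
  refine hc.congr ?_
  filter_upwards [Iio_mem_nhds h] with l hl
  exact (phiDD_eq_gaussMoment hl x).symm

lemma continuousOn_x1 : ContinuousOn x1 (Ioo (0 : ℝ) (1 / 2)) := by
  intro lam h
  have hI : Ioo (0 : ℝ) (1 / 2) ∈ 𝓝 lam := isOpen_Ioo.mem_nhds h
  refine ContinuousAt.continuousWithinAt (tendsto_order.2 ⟨fun a ha => ?_, fun b hb => ?_⟩)
  · have ha0 := ha.trans (isX1_x1 h).1
    rw [lt_x1_iff h ha0] at ha
    filter_upwards [(continuousAt_phiDD_left h.2 a).eventually (lt_mem_nhds ha), hI] with l hl hlI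
    exact (lt_x1_iff hlI ha0).2 hl
  · rcases lt_or_ge b 0 with hb0 | hb0
    · rw [gt_iff_lt, x1_lt_iff h hb0] at hb
      filter_upwards [(continuousAt_phiDD_left h.2 b).eventually (gt_mem_nhds hb), hI]
        with l hl hlI
      exact (x1_lt_iff hlI hb0).2 hl
    · filter_upwards [hI] with l hlI
      exact (isX1_x1 hlI).1.trans_le hb0

lemma continuousOn_zCrit : ContinuousOn zCrit (Ioo (0 : ℝ) (1 / 2)) := by
  intro lam h
  have hI : Ioo (0 : ℝ) (1 / 2) ∈ 𝓝 lam := isOpen_Ioo.mem_nhds h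
  have hc : ∀ x, ContinuousAt (fun l => evenDD l x) lam := fun x =>
    (continuousAt_phiDD_left h.2 x).add (continuousAt_phiDD_left h.2 (-x))
  refine ContinuousAt.continuousWithinAt (tendsto_order.2 ⟨fun a ha => ?_, fun b hb => ?_⟩)
  · rcases lt_or_ge 0 a with ha0 | ha0
    · rw [lt_zCrit_iff h ha0] at ha
      filter_upwards [(hc a).eventually (gt_mem_nhds ha), hI] with l hl hlI
      exact (lt_zCrit_iff hlI ha0).2 hl
    · filter_upwards [hI] with l hlI
      exact ha0.trans_lt (isZ_zCrit hlI).1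
  · have hb0 := (isZ_zCrit h).1.trans hb
    rw [gt_iff_lt, zCrit_lt_iff h hb0] at hb
    filter_upwards [(hc b).eventually (lt_mem_nhds hb), hI] with l hl hlI
    exact (zCrit_lt_iff hlI hb0).2 hl

/-- After rescaling, the weight y^{-2λ} concentrates at y = 0, so the limit is the second derivative
of e^{-x²/2}, with zeros ±1. -/
lemma tendsto_one_sub_mul_phiDD (x : ℝ) :
    Tendsto (fun lam => (1 - 2 * lam) * phiDD lam x) (𝓝[<] (1 / 2))
      (𝓝 ((x ^ 2 - 1) * Real.exp (-x ^ 2 / 2))) := by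
  have c1 : ContinuousAt (fun l : ℝ => gaussMoment (-2 * l + 1) x) (1 / 2) :=
    (continuousAt_gaussMoment (s := -2 * (1 / 2) + 1) (by norm_num) x).comp
      (f := fun l : ℝ => -2 * l + 1) (by fun_prop)
  have c2 : ContinuousAt (fun l : ℝ => gaussMoment (-2 * l + 2) x) (1 / 2) :=
    (continuousAt_gaussMoment (s := -2 * (1 / 2) + 2) (by norm_num) x).comp
      (f := fun l : ℝ => -2 * l + 2) (by fun_prop)
  have hc : ContinuousAt (fun l : ℝ => (x ^ 2 - 2 * l) * gaussMoment (-2 * l + 2) x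
      - x * (x ^ 2 + 1 - 4 * l) * gaussMoment (-2 * l + 1) x) (1 / 2) := by fun_prop
  have ht := hc.tendsto.mono_left (nhdsWithin_le_nhds (s := Iio (1 / 2)))
  have e : (x ^ 2 - 2 * (1 / 2)) * gaussMoment (-2 * (1 / 2) + 2) x
      - x * (x ^ 2 + 1 - 4 * (1 / 2)) * gaussMoment (-2 * (1 / 2) + 1) x
      = (x ^ 2 - 1) * Real.exp (-x ^ 2 / 2) := by
    rw [← gaussMoment_one, show (-2 * (1 / 2) + 2 : ℝ) = 1 by norm_num,
      show (-2 * (1 / 2) + 1 : ℝ) = 0 by norm_num]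
    ring
  rw [e] at ht
  refine ht.congr' ?_
  filter_upwards [self_mem_nhdsWithin] with l hl
  exact (one_sub_mul_phiDD hl x).symm

lemma eventually_x1_lt {x : ℝ} (hx : x ∈ Ioo (-1 : ℝ) 0) :
    ∀ᶠ lam in 𝓝[<] (1 / 2), x1 lam < x := by
  have hneg : (x ^ 2 - 1) * Real.exp (-x ^ 2 / 2) < 0 :=
    mul_neg_of_neg_of_pos (by nlinarith [hx.1, hx.2]) (Real.exp_pos _)
  filter_upwards [(tendsto_one_sub_mul_phiDD x).eventually (gt_mem_nhds hneg),
    Ioo_mem_nhdsLT (by norm_num : (0 : ℝ) < 1 / 2)] with l hl hlI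
  rw [x1_lt_iff hlI hx.2]
  exact neg_of_mul_neg_right hl (by linarith [hlI.2])

lemma eventually_zCrit_lt {x : ℝ} (hx : 1 < x) :
    ∀ᶠ lam in 𝓝[<] (1 / 2), zCrit lam < x := by
  have hpos : 0 < (x ^ 2 - 1) * Real.exp (-x ^ 2 / 2)
      + ((-x) ^ 2 - 1) * Real.exp (-(-x) ^ 2 / 2) := by
    have h1 : 0 < x ^ 2 - 1 := by nlinarith
    rw [neg_sq]
    positivity
  filter_upwards [((tendsto_one_sub_mul_phiDD x).add
    (tendsto_one_sub_mul_phiDD (-x))).eventually (lt_mem_nhds hpos),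
    Ioo_mem_nhdsLT (by norm_num : (0 : ℝ) < 1 / 2)] with l hl hlI
  rw [zCrit_lt_iff hlI (one_pos.trans hx)]
  rw [← mul_add] at hl
  exact pos_of_mul_pos_right hl (by linarith [hlI.2])

/-! ### The ratio σ_λ and the critical exponent -/

lemma sigmaCrit_eq (lam : ℝ) : sigmaCrit lam = -x1 lam / zCrit lam := by
  rw [sigmaCrit, neg_div]

theorem strictMonoOn_sigmaCrit : StrictMonoOn sigmaCrit (Ioo (0 : ℝ) (1 / 2)) := by
  intro lam hl mu hm hlm
  rw [sigmaCrit_eq, sigmaCrit_eq]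
  exact div_lt_div₀ (neg_lt_neg (strictAntiOn_x1 hl hm hlm)) (strictAntiOn_zCrit hl hm hlm).le
    (by linarith [(isX1_x1 hm).1]) (isZ_zCrit hm).1

lemma continuousOn_sigmaCrit : ContinuousOn sigmaCrit (Ioo (0 : ℝ) (1 / 2)) :=
  (continuousOn_x1.div continuousOn_zCrit fun _ h => (isZ_zCrit h).1.ne').neg

theorem sigmaCrit_sq_lt {lam : ℝ} (h : lam ∈ Ioo (0 : ℝ) (1 / 2)) :
    sigmaCrit lam ^ 2 < 2 * lam := by
  have hz := one_lt_zCrit h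
  rw [sigmaCrit, neg_sq, div_pow]
  exact (div_le_self (sq_nonneg _) (by nlinarith)).trans_lt (x1_sq_lt h)

lemma exists_lt_sigmaCrit {sigma : ℝ} (hs : sigma ∈ Ioo (0 : ℝ) 1) :
    ∃ lam ∈ Ioo (0 : ℝ) (1 / 2), sigma < sigmaCrit lam := by
  obtain ⟨h0, h1⟩ := hs
  -- The thresholds (1+σ)/2 < 1 for -x₁ and (1+σ)/(2σ) > 1 for z have quotient exactly σ.
  have hz : 1 < (1 + sigma) / (2 * sigma) := by
    rw [one_lt_div (by linarith)]
    linarith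
  obtain ⟨lam, ⟨hx, hz'⟩, hI⟩ := ((eventually_x1_lt (x := -((1 + sigma) / 2))
    ⟨by linarith, by linarith⟩).and (eventually_zCrit_lt hz)).and
    (Ioo_mem_nhdsLT (by norm_num : (0 : ℝ) < 1 / 2)) |>.exists
  refine ⟨lam, hI, ?_⟩
  rw [lt_div_iff₀ (by linarith)] at hz'
  rw [sigmaCrit_eq, lt_div_iff₀ (isZ_zCrit hI).1]
  linarith

theorem existsUnique_isCritical {sigma : ℝ} (hs : sigma ∈ Ioo (0 : ℝ) 1) :
    ∃! lam, IsCritical sigma lam := by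
  have ha : sigma ^ 2 / 2 ∈ Ioo (0 : ℝ) (1 / 2) := by
    constructor <;> nlinarith [hs.1, hs.2]
  obtain ⟨b, hb, hbs⟩ := exists_lt_sigmaCrit hs
  -- At λ = σ²/2 the bound σ_λ² < 2λ reads σ_λ² < σ².
  have has : sigmaCrit (sigma ^ 2 / 2) < sigma :=
    lt_of_pow_lt_pow_left₀ 2 hs.1.le (by linarith [sigmaCrit_sq_lt ha])
  obtain ⟨lam, hlam, he⟩ := isPreconnected_Ioo.intermediate_value ha hb continuousOn_sigmaCrit
    ⟨has.le, hbs.le⟩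
  exact ⟨lam, ⟨hlam, he⟩, fun mu hmu =>
    strictMonoOn_sigmaCrit.injOn hmu.1 hlam (hmu.2.trans he.symm)⟩

end GHeat

/-- The first two conjuncts say that `x_1^λ`, `z^λ` and `λ_σ` are well defined, so that the last
one is about the numbers they are meant to denote. -/
theorem proposition2115 (sigma : ℝ) (hsigma : sigma ∈ Set.Ioo (0 : ℝ) 1) :
    (∀ lam ∈ Set.Ioo (0 : ℝ) (1 / 2),
      (∃! x : ℝ, GHeat.IsX1 lam x) ∧ (∃! z : ℝ, GHeat.IsZ lam z)) ∧
    (∃! lam : ℝ, GHeat.IsCritical sigma lam) ∧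
    sigma ^ 2 / 2 < GHeat.lambdaCrit sigma := by
  have hex := GHeat.existsUnique_isCritical hsigma
  have hcrit : GHeat.IsCritical sigma (GHeat.lambdaCrit sigma) :=
    Classical.epsilon_spec hex.exists
  refine ⟨fun lam h => ⟨GHeat.existsUnique_isX1 h, GHeat.existsUnique_isZ h⟩, hex, ?_⟩
  have := GHeat.sigmaCrit_sq_lt hcrit.1
  rw [hcrit.2] at this
  linarith
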